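/- Consider the cycle with node set $\{1,\dots,n\}$, oriented as the circuit $(1,2,\dots,n)$. For distinct nodes $i,j$ let $[i,j]$ be the directed path from $i$ to $j$ in this circuit and $V([i,j])$ its set of nodes. A demand is a pair $p=(i,j)$ with $1\le i<j\le n$; it can be routed through $p^+=[i,j]$ or through $p^-=[j,i]$. An instance of the Minimum Clique Routing Problem on Cycles (MCRPC) consists of such a cycle, a finite family $\mathcal D$ of demands (different demands may have the same ends) and arbitrary real weights $\mathbf w=(\mathbf w_p)_{p\in\mathcal D}$. A routing $R$ chooses a route $R_p\in\{p^+,p^-\}$ for every $p\in\mathcal D$. Let $H_R$ be the graph with vertex set $\mathcal D$ in which two distinct demands $p,q$ are adjacent if and only if $R_p$ and $R_q$ share at least one arc, and let $\omega(H_R,\mathbf w)$ be the maximum weight $\sum_{p\in K}\mathbf w_p$ of a clique $K$ of $H_R$ (the empty clique, of weight $0$, is allowed). The task is to find a routing that minimizes $\omega(H_R,\mathbf w)$; the minimum is denoted by $c\ell(\mathcal D,\mathbf w)$. **Theorem.** The MCRPC with arbitrary weights has a $2$-approximation algorithm that runs in time $O(|\mathcal D|^3)$. More precisely, there is an algorithm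 (a program for a random access machine with unit cost, with addition, subtraction and comparison of numbers) that, on every instance, outputs within $O(|\mathcal D|^3)$ steps, uniformly in $n$ and $\mathbf w$, the routing $S$ in which each $p\in\mathcal D$ is routed along its shorter side, that is, $S_p=p^+$ if $|V(p^+)|\le|V(p^-)|$ and $S_p=p^-$ otherwise; and $$\omega(H_S,\mathbf w)\le 2\,c\ell(\mathcal D,\mathbf w).$$ -/

import Mathlib

open Filter Asymptotics

namespace MCRPC

/-! ### Demands and routes on the cycle

The nodes of the cycle are `1, …, n`; the arc `a` (with `1 ≤ a ≤ n`) goes from the node `a` to the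
node `a + 1`, except that the arc `n` goes from the node `n` to the node `1`. -/

/-- A demand on the cycle with nodes `1, …, n`: a pair `(i, j)` with `1 ≤ i < j ≤ n`. -/
structure Demand (n : ℕ) where
  i : ℕ
  j : ℕ
  one_le_i : 1 ≤ i
  i_lt_j : i < j
  j_le_n : j ≤ n

/-- The arcs of the directed path `[i, j]` from `i` to `j` in the circuit `(1, 2, …, n)`
(for two distinct nodes `i`, `j`). -/
def pathArcs (n i j : ℕ) : Finset ℕ :=
  if i < j then Finset.Ico i j else Finset.Icc i n ∪ Finset.Ico 1 j

/-- The nodes of the directed path `[i, j]` from `i` to `j` in the circuit `(1, 2, …, n)`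
(for two distinct nodes `i`, `j`). -/
def pathNodes (n i j : ℕ) : Finset ℕ :=
  if i < j then Finset.Icc i j else Finset.Icc i n ∪ Finset.Icc 1 j

/-- The arcs of the route of a demand `p = (i, j)`: `true` stands for `p⁺ = [i, j]` and `false`
for `p⁻ = [j, i]`. -/
def Demand.arcs {n : ℕ} (p : Demand n) : Bool → Finset ℕ
  | true => pathArcs n p.i p.j
  | false => pathArcs n p.j p.i

/-- The nodes of the route of a demand: `V(p⁺)` for `true` and `V(p⁻)` for `false`. -/
def Demand.nodes {n : ℕ} (p : Demand n) : Bool → Finset ℕ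
  | true => pathNodes n p.i p.j
  | false => pathNodes n p.j p.i

/-- An instance: a cycle with `n` nodes and a finite family of `m = |𝒟|` demands (several demands
may have the same ends), each with a real weight. -/
structure Instance where
  n : ℕ
  m : ℕ
  demand : Fin m → Demand n
  weight : Fin m → ℝ

/-- A routing chooses `p⁺` (`true`) or `p⁻` (`false`) for every demand `p`. -/
abbrev Routing (I : Instance) : Type := Fin I.m → Bool

/-- The intersection graph `H` of all the routes: one vertex for every demand and each of its two
routes; two distinct vertices are adjacent iff the routes share at least one arc. -/
def routeGraph (I : Instance) : SimpleGraph (Fin I.m × Bool) where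
  Adj u v := u ≠ v ∧ ¬ Disjoint ((I.demand u.1).arcs u.2) ((I.demand v.1).arcs v.2)
  symm := ⟨fun _ _ h => ⟨h.1.symm, fun d => h.2 d.symm⟩⟩
  loopless := ⟨fun _ h => h.1 rfl⟩

/-- The subgraph `H_R` of `H` induced by the routes of the routing `R`; the vertex of the route
`R p` is identified with the demand `p`. -/
def routingGraph (I : Instance) (R : Routing I) : SimpleGraph (Fin I.m) :=
  (routeGraph I).comap fun p => (p, R p)

open Classical in
/-- The maximum weight of a clique of a finite graph (the empty clique has weight `0`). -/
noncomputable def maxCliqueWeight {V : Type*} [Fintype V] (G : SimpleGraph V) (w : V → ℝ) : ℝ :=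
  (Finset.univ.filter fun K : Finset V => G.IsClique (K : Set V)).sup'
    ⟨∅, by simp⟩ fun K => ∑ p ∈ K, w p

/-- The cost `ω(H_R, w)` of a routing `R`. -/
noncomputable def cost (I : Instance) (R : Routing I) : ℝ :=
  maxCliqueWeight (routingGraph I R) I.weight

/-- The optimum `cℓ(𝒟, w)`: the minimum of `ω(H_R, w)` over all routings `R`. -/
noncomputable def optimum (I : Instance) : ℝ :=
  (Finset.univ : Finset (Routing I)).inf' Finset.univ_nonempty (cost I)

/-- The routing along the shorter sides: `p` is routed through `p⁺` if `|V(p⁺)| ≤ |V(p⁻)|` and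
through `p⁻` otherwise. -/
def shorterSide (I : Instance) : Routing I := fun p =>
  decide (((I.demand p).nodes true).card ≤ ((I.demand p).nodes false).card)

/-! ### The machine model

A random access machine with unit cost. It has registers and an indirectly addressed memory for
natural numbers, and separate registers and an indirectly addressed memory for weights (real
numbers), which can only be moved, added, subtracted and compared. -/

/-- Instructions. The arguments name registers, except for the constant `c` of `const` and the jump
targets `l`, which are positions in the program. -/
inductive Instr where
  /-- `r ← c` -/
  | const (r c : ℕ)
  /-- `r ← a + b` -/
  | add (r a b : ℕ)
  /-- `r ← a - b` (truncated at `0`) -/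
  | sub (r a b : ℕ)
  /-- `r ← mem[a]` -/
  | load (r a : ℕ)
  /-- `mem[a] ← b` -/
  | store (a b : ℕ)
  /-- if `a ≤ b` go to `l` -/
  | jumpLE (a b l : ℕ)
  /-- weight register `r ← 0` -/
  | wzero (r : ℕ)
  /-- weight registers: `r ← a + b` -/
  | wadd (r a b : ℕ)
  /-- weight registers: `r ← a - b` -/
  | wsub (r a b : ℕ)
  /-- weight register `r ← wmem[a]` -/
  | wload (r a : ℕ)
  /-- `wmem[a] ←` weight register `b` -/
  | wstore (a b : ℕ)
  /-- if weight registers `a ≤ b` go to `l` -/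
  | wjumpLE (a b l : ℕ)

/-- A program is a finite list of instructions. -/
abbrev Program : Type := List Instr

/-- A configuration of the machine; `pc` is the position of the next instruction. -/
structure Config where
  pc : ℕ
  reg : ℕ → ℕ
  mem : ℕ → ℕ
  wreg : ℕ → ℝ
  wmem : ℕ → ℝ

open Classical in
/-- The effect of one instruction. -/
noncomputable def Instr.exec (s : Config) : Instr → Config
  | .const r c => { s with pc := s.pc + 1, reg := Function.update s.reg r c }
  | .add r a b => { s with pc := s.pc + 1, reg := Function.update s.reg r (s.reg a + s.reg b) }
  | .sub r a b => { s with pc := s.pc + 1, reg := Function.update s.reg r (s.reg a - s.reg b) }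
  | .load r a => { s with pc := s.pc + 1, reg := Function.update s.reg r (s.mem (s.reg a)) }
  | .store a b => { s with pc := s.pc + 1, mem := Function.update s.mem (s.reg a) (s.reg b) }
  | .jumpLE a b l => { s with pc := if s.reg a ≤ s.reg b then l else s.pc + 1 }
  | .wzero r => { s with pc := s.pc + 1, wreg := Function.update s.wreg r 0 }
  | .wadd r a b =>
      { s with pc := s.pc + 1, wreg := Function.update s.wreg r (s.wreg a + s.wreg b) }
  | .wsub r a b =>
      { s with pc := s.pc + 1, wreg := Function.update s.wreg r (s.wreg a - s.wreg b) }
  | .wload r a => { s with pc := s.pc + 1, wreg := Function.update s.wreg r (s.wmem (s.reg a)) }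
  | .wstore a b => { s with pc := s.pc + 1, wmem := Function.update s.wmem (s.reg a) (s.wreg b) }
  | .wjumpLE a b l => { s with pc := if s.wreg a ≤ s.wreg b then l else s.pc + 1 }

/-- One step of the program; the machine stands still once `pc` has left the program. -/
noncomputable def step (P : Program) (s : Config) : Config :=
  match P[s.pc]? with
  | some instr => instr.exec s
  | none => s

/-- The machine has halted: `pc` has left the program. -/
def Halted (P : Program) (s : Config) : Prop := P.length ≤ s.pc

/-- The initial configuration on an instance: `n` and `m` are in the registers `0` and `1`, the ends
of the demand `k` (`k = 0, …, m - 1`) are in the memory cells `2 k` and `2 k + 1`, and its weight is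
in the weight memory cell `k`; everything else is `0`. -/
noncomputable def start (I : Instance) : Config where
  pc := 0
  reg := fun r => if r = 0 then I.n else if r = 1 then I.m else 0
  mem := fun c =>
    if h : c / 2 < I.m then
      if c % 2 = 0 then (I.demand ⟨c / 2, h⟩).i else (I.demand ⟨c / 2, h⟩).j
    else 0
  wreg := fun _ => 0
  wmem := fun c => if h : c < I.m then I.weight ⟨c, h⟩ else 0

/-- The configuration holds the routing `R` as its output: the memory cell `2 m + k`, behind the
input, is `1` if the demand `k` is routed through `p⁺` and `0` if it is routed through `p⁻`. -/
def IsOutput {I : Instance} (s : Config) (R : Routing I) : Prop :=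
  ∀ k : Fin I.m, s.mem (2 * I.m + k) = if R k then 1 else 0

/-- On the instance `I` the program `P` halts after at most `t` steps, with output `R`. -/
def OutputsWithin (P : Program) (I : Instance) (R : Routing I) (t : ℕ) : Prop :=
  ∃ t' ≤ t, Halted P ((step P)^[t'] (start I)) ∧ IsOutput ((step P)^[t'] (start I)) R

end MCRPC

/-! The cost bound. Let `S` be the routing along the shorter sides and let `R` be any routing. A
clique `K` of `H_S` only gets heavier when the demands of negative weight are dropped, and what
remains is the union of the demands on which `R` and `S` agree and of those on which they differ.
Both parts are cliques of `H_R`: this is clear for the first, and for the second it says that if the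
shorter sides of two demands share an arc, then so do their longer sides
(`longer_sides_not_disjoint`). Indeed, if the longer sides were disjoint, then each would be
contained in the shorter side of the other demand; counting arcs turns these inclusions into
equalities, and the shorter sides would be disjoint as well. Hence the weight of `K` is at most twice
the cost of `R` (`cost_shorterSide_le`).

The running time. One loop, with a body free of branches, treats the demands one after another:
`p⁺` is a shorter side of `p = (i, j)` iff `2 j ≤ 2 i + n`, that is, iff the truncated difference
`x = (2 i + n + 1) - 2 j` is positive, and then `1 - (1 - x)` is the bit to be stored. Every round
takes 16 steps (`iterate_step_loop`), so the running time is even linear in the number of demands. -/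

namespace MCRPC

/-! ### Shorter and longer sides of a demand -/

theorem Demand.disjoint_arcs_not {n : ℕ} (p : Demand n) (b : Bool) :
    Disjoint (p.arcs b) (p.arcs !b) := by
  have h := p.i_lt_j
  rw [Finset.disjoint_left]
  cases b <;> simp [Demand.arcs, pathArcs, h, h.not_gt] <;> omega

theorem Demand.arcs_union_arcs_not {n : ℕ} (p : Demand n) (b : Bool) :
    p.arcs b ∪ p.arcs (!b) = Finset.Icc 1 n := by
  have h1 := p.one_le_i
  have h2 := p.i_lt_j
  have h3 := p.j_le_n
  ext a
  cases b <;> simp [Demand.arcs, pathArcs, h2, h2.not_gt] <;> omega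

theorem Demand.card_arcs_true {n : ℕ} (p : Demand n) : (p.arcs true).card = p.j - p.i := by
  simp [Demand.arcs, pathArcs, p.i_lt_j]

theorem Demand.card_arcs_false {n : ℕ} (p : Demand n) :
    (p.arcs false).card = n - (p.j - p.i) := by
  have h := Finset.card_union_of_disjoint (p.disjoint_arcs_not true)
  rw [p.arcs_union_arcs_not, p.card_arcs_true, Nat.card_Icc] at h
  simp only [Bool.not_true] at h
  omega

theorem Demand.card_nodes_true {n : ℕ} (p : Demand n) :
    (p.nodes true).card = p.j - p.i + 1 := by
  have h := p.i_lt_j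
  simp only [Demand.nodes, pathNodes, h, if_true, Nat.card_Icc]
  omega

theorem Demand.card_nodes_false {n : ℕ} (p : Demand n) :
    (p.nodes false).card = n - (p.j - p.i) + 1 := by
  have h := p.i_lt_j
  have h1 := p.one_le_i
  have h3 := p.j_le_n
  have hd : Disjoint (Finset.Icc p.j n) (Finset.Icc 1 p.i) := by
    rw [Finset.disjoint_left]
    simp
    omega
  simp only [Demand.nodes, pathNodes, h.not_gt, if_false]
  rw [Finset.card_union_of_disjoint hd, Nat.card_Icc, Nat.card_Icc]
  omega

theorem shorterSide_eq (I : Instance) (k : Fin I.m) :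
    shorterSide I k = decide (2 * (I.demand k).j ≤ 2 * (I.demand k).i + I.n) := by
  have h := (I.demand k).i_lt_j
  have h3 := (I.demand k).j_le_n
  rw [shorterSide, decide_eq_decide, Demand.card_nodes_true, Demand.card_nodes_false]
  omega

/-- A path with at most as many nodes as its complement also has at most as many arcs. -/
theorem card_arcs_shorterSide_le (I : Instance) (k : Fin I.m) :
    ((I.demand k).arcs (shorterSide I k)).card ≤ ((I.demand k).arcs (!shorterSide I k)).card := by
  have h := shorterSide_eq I k
  have h2 := (I.demand k).i_lt_j
  have h3 := (I.demand k).j_le_n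
  have ht := (I.demand k).card_arcs_true
  have hf := (I.demand k).card_arcs_false
  cases hs : shorterSide I k <;> rw [hs] at h
  · have := of_decide_eq_false h.symm
    simp only [Bool.not_false]
    omega
  · have := of_decide_eq_true h.symm
    simp only [Bool.not_true]
    omega

theorem Demand.arcs_not_subset_of_disjoint {n : ℕ} {p q : Demand n} {b c : Bool}
    (h : Disjoint (p.arcs b) (q.arcs c)) : p.arcs b ⊆ q.arcs (!c) := by
  intro a ha
  have hu : a ∈ q.arcs c ∪ q.arcs (!c) := by
    rw [q.arcs_union_arcs_not, ← p.arcs_union_arcs_not b]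
    exact Finset.mem_union_left _ ha
  exact (Finset.mem_union.1 hu).resolve_left (Finset.disjoint_left.1 h ha)

/-- If the shorter sides of two demands share an arc, then so do their longer sides. -/
theorem longer_sides_not_disjoint (I : Instance) (p q : Fin I.m)
    (h : ¬ Disjoint ((I.demand p).arcs (shorterSide I p)) ((I.demand q).arcs (shorterSide I q))) :
    ¬ Disjoint ((I.demand p).arcs (!shorterSide I p)) ((I.demand q).arcs (!shorterSide I q)) := by
  intro hd
  apply h
  have hpq := Demand.arcs_not_subset_of_disjoint hd
  have hqp := Demand.arcs_not_subset_of_disjoint hd.symm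
  rw [Bool.not_not] at hpq hqp
  have hp := card_arcs_shorterSide_le I p
  have hq := card_arcs_shorterSide_le I q
  have hle := Finset.card_le_card hqp
  rw [← Finset.eq_of_subset_of_card_le hpq (by omega)]
  exact (I.demand p).disjoint_arcs_not _

/-! ### The cost of the routing along the shorter sides -/

theorem sum_le_cost {I : Instance} {R : Routing I} {K : Finset (Fin I.m)}
    (hK : (routingGraph I R).IsClique (K : Set (Fin I.m))) :
    ∑ p ∈ K, I.weight p ≤ cost I R := by
  classical
  exact Finset.le_sup' (fun K : Finset (Fin I.m) => ∑ p ∈ K, I.weight p) (by simpa using hK)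

theorem routingGraph_adj {I : Instance} {R : Routing I} {p q : Fin I.m} :
    (routingGraph I R).Adj p q ↔
      p ≠ q ∧ ¬ Disjoint ((I.demand p).arcs (R p)) ((I.demand q).arcs (R q)) := by
  simp only [routingGraph, routeGraph, SimpleGraph.comap_adj, ne_eq, Prod.mk.injEq, not_and]
  constructor
  · rintro ⟨h1, h2⟩
    exact ⟨fun h => h1 h (h ▸ rfl), h2⟩
  · rintro ⟨h1, h2⟩
    exact ⟨fun h => absurd h h1, h2⟩

theorem cost_shorterSide_le (I : Instance) (R : Routing I) :
    cost I (shorterSide I) ≤ 2 * cost I R := by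
  classical
  refine Finset.sup'_le ⟨∅, by simp⟩ _ fun K hK => ?_
  replace hK : (routingGraph I (shorterSide I)).IsClique (K : Set (Fin I.m)) := by simpa using hK
  set K₀ := K.filter fun p => 0 ≤ I.weight p
  have hpos : ∑ p ∈ K, I.weight p ≤ ∑ p ∈ K₀, I.weight p := by
    rw [Finset.sum_filter]
    refine Finset.sum_le_sum fun p _ => ?_
    split_ifs with h
    · exact le_rfl
    · exact (not_le.1 h).le
  have hagree : ∑ p ∈ K₀.filter (fun p => R p = shorterSide I p), I.weight p ≤ cost I R := by
    refine sum_le_cost fun p hp q hq hne => ?_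
    simp only [K₀, Finset.coe_filter, Finset.mem_filter, Set.mem_ofPred_eq] at hp hq
    have h := routingGraph_adj.1 (hK hp.1.1 hq.1.1 hne)
    rw [routingGraph_adj, hp.2, hq.2]
    exact h
  have hdiffer : ∑ p ∈ K₀.filter (fun p => ¬ R p = shorterSide I p), I.weight p ≤ cost I R := by
    refine sum_le_cost fun p hp q hq hne => ?_
    simp only [K₀, Finset.coe_filter, Finset.mem_filter, Set.mem_ofPred_eq] at hp hq
    have h := routingGraph_adj.1 (hK hp.1.1 hq.1.1 hne)
    rw [routingGraph_adj, Bool.eq_not.2 hp.2, Bool.eq_not.2 hq.2]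
    exact ⟨hne, longer_sides_not_disjoint I p q h.2⟩
  have hsplit := Finset.sum_filter_add_sum_filter_not K₀ (fun p => R p = shorterSide I p) I.weight
  linarith

theorem cost_shorterSide_le_optimum (I : Instance) :
    cost I (shorterSide I) ≤ 2 * optimum I := by
  obtain ⟨R, -, hR⟩ := Finset.exists_mem_eq_inf'
    (Finset.univ_nonempty (α := Routing I)) (cost I)
  rw [optimum, hR]
  exact cost_shorterSide_le I R

/-! ### The program -/

/-- The program that routes every demand along its shorter side. Register `2` holds the number `k`
of demands already treated, register `3` the address `2 k` of the next demand, register `4` the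
constant `1`, and register `7` the address `2 m + k` of the next output bit; the loop begins at
position `2`. -/
def shorterSideProgram : Program :=
  [ .const 4 1,
    .add 7 1 1,
    .jumpLE 1 2 18,
    .load 5 3,
    .add 3 3 4,
    .load 6 3,
    .add 3 3 4,
    .add 5 5 5,
    .add 5 5 0,
    .add 5 5 4,
    .add 6 6 6,
    .sub 5 5 6,
    .sub 5 4 5,
    .sub 5 4 5,
    .store 7 5,
    .add 7 7 4,
    .add 2 2 4,
    .jumpLE 0 0 2 ]

/-- The loop invariant: `s` is at the head of the loop, the first `k` demands have been routed, and
the part of the memory that holds the demands is unchanged. -/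
structure AtLoopHead (I : Instance) (k : ℕ) (s : Config) : Prop where
  pc : s.pc = 2
  reg_zero : s.reg 0 = I.n
  reg_one : s.reg 1 = I.m
  reg_two : s.reg 2 = k
  reg_three : s.reg 3 = 2 * k
  reg_four : s.reg 4 = 1
  reg_seven : s.reg 7 = 2 * I.m + k
  mem_i : ∀ l : Fin I.m, s.mem (2 * l) = (I.demand l).i
  mem_j : ∀ l : Fin I.m, s.mem (2 * l + 1) = (I.demand l).j
  mem_out : ∀ l : Fin I.m, (l : ℕ) < k → s.mem (2 * I.m + l) = if shorterSide I l then 1 else 0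

theorem atLoopHead_start (I : Instance) :
    AtLoopHead I 0 ((step shorterSideProgram)^[2] (start I)) := by
  constructor <;>
    simp [step, shorterSideProgram, Instr.exec, start, Function.update, two_mul]
  case mem_i =>
    intro l
    simp [show ((l : ℕ) + l) / 2 = l by omega, show ((l : ℕ) + l) % 2 = 0 by omega]
  case mem_j =>
    intro l
    simp [show ((l : ℕ) + l + 1) / 2 = l by omega, show ((l : ℕ) + l + 1) % 2 = 1 by omega]

/-- One round of the loop takes 16 steps. -/
theorem iterate_step_loop {I : Instance} {k : ℕ} (hk : k < I.m) {s : Config}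
    (h : AtLoopHead I k s) : AtLoopHead I (k + 1) ((step shorterSideProgram)^[16] s) := by
  obtain ⟨pc, reg, mem, wreg, wmem⟩ := s
  obtain ⟨h, h0, h1, h2, h3, h4, h7, hi, hj, ho⟩ := h
  dsimp only at h h0 h1 h2 h3 h4 h7 hi hj ho
  subst h
  have hki := hi ⟨k, hk⟩
  have hkj := hj ⟨k, hk⟩
  dsimp only at hki hkj
  have hbit : 1 - (1 - ((I.demand ⟨k, hk⟩).i + (I.demand ⟨k, hk⟩).i + I.n + 1 -
      ((I.demand ⟨k, hk⟩).j + (I.demand ⟨k, hk⟩).j))) =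
        if shorterSide I ⟨k, hk⟩ then 1 else 0 := by
    simp only [shorterSide_eq, decide_eq_true_eq]
    split_ifs <;> omega
  constructor <;>
    simp [step, shorterSideProgram, Instr.exec, Function.update, h0, h1, h2, h3, h4, h7,
      hki, hkj, not_le.2 hk]
  case reg_three => ring
  case reg_seven => ring
  case mem_i =>
    intro l
    rw [if_neg (by omega), hi]
  case mem_j =>
    intro l
    rw [if_neg (by omega), hj]
  case mem_out =>
    intro l hl
    obtain rfl | hlt := hl.eq_or_lt
    · rw [if_pos rfl, hbit]
    · rw [if_neg hlt.ne, ho l hlt]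

theorem atLoopHead_iterate (I : Instance) (k : ℕ) (hk : k ≤ I.m) :
    AtLoopHead I k ((step shorterSideProgram)^[16 * k + 2] (start I)) := by
  induction k with
  | zero => exact atLoopHead_start I
  | succ k ih =>
    rw [show 16 * (k + 1) + 2 = 16 + (16 * k + 2) by ring, Function.iterate_add_apply]
    exact iterate_step_loop hk (ih (by omega))

theorem outputsWithin_shorterSideProgram (I : Instance) :
    OutputsWithin shorterSideProgram I (shorterSide I) (16 * I.m + 3) := by
  have h := atLoopHead_iterate I I.m le_rfl
  refine ⟨16 * I.m + 3, le_rfl, ?_⟩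
  rw [Function.iterate_succ_apply']
  generalize (step shorterSideProgram)^[16 * I.m + 2] (start I) = s at h
  -- The conditional jump at the head of the loop leaves the program.
  have hs : step shorterSideProgram s = { s with pc := 18 } := by
    simp [step, shorterSideProgram, Instr.exec, h.pc, h.reg_one, h.reg_two]
  rw [hs]
  exact ⟨by simp [Halted, shorterSideProgram], fun k => h.mem_out k k.is_lt⟩

end MCRPC

/-- One program, for all instances, outputs the routing along the shorter sides in time
`O(|𝒟|³)` (uniformly in the cycle and the weights), and the cost of this routing is at most twice
the optimum. -/
theorem theorem2 :
    ∃ (P : MCRPC.Program) (T : ℕ → ℕ),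
      (fun m : ℕ => (T m : ℝ)) =O[atTop] (fun m : ℕ => (m : ℝ) ^ 3) ∧
      ∀ I : MCRPC.Instance, ∃ S : MCRPC.Routing I,
        MCRPC.OutputsWithin P I S (T I.m) ∧
        S = MCRPC.shorterSide I ∧
        MCRPC.cost I S ≤ 2 * MCRPC.optimum I := by
  refine ⟨MCRPC.shorterSideProgram, fun m => 16 * m + 3, ?_, fun I => ⟨_,
    MCRPC.outputsWithin_shorterSideProgram I, rfl, MCRPC.cost_shorterSide_le_optimum I⟩⟩
  refine IsBigO.of_bound 19 ?_
  filter_upwards [eventually_ge_atTop 1] with m hm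
  rw [Real.norm_of_nonneg (by positivity), Real.norm_of_nonneg (by positivity)]
  have h : 16 * m + 3 ≤ 19 * m ^ 3 := by
    have := Nat.le_self_pow three_ne_zero m
    omega
  exact_mod_cast h
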